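/- **Setting.** Let $n\ge 2$, and let $\Omega\subset\mathbb R^n$ be an open set with Lipschitz boundary $\Gamma=\partial\Omega$ that is either bounded or the half-space $\{x_n>0\}$. Let $G\subset\Gamma$ be a bounded, relatively open subset with Lipschitz relative boundary. Let $\sigma>0$ and $\mu>0$. All functions below carry the exponential weight $e^{-\sigma t}$ (so $w_\sigma=e^{-\sigma t}w$, $u_\sigma=e^{-\sigma t}u$, $h_\sigma=e^{-\sigma t}h$), and the unit normal $\nu$ on $\Gamma$ points into $\Omega$. **Spaces.** For $\omega=\xi+i\sigma$, $\xi\in\mathbb R$, equip $H^{1/2}(\Gamma)$ with the norm $$\|v\|_{1/2,\omega}^2=|\omega|\int_\Gamma|v|^2\,ds+\iint_{\Gamma\times\Gamma}\frac{|v(x)-v(y)|^2}{|x-y|^n}\,ds_x\,ds_y .$$ For $S\subset\Gamma$ let $X_S=H^{1/2}_\sigma(\mathbb R^+,\tilde H^{1/2}(S))$ be the space of real functions $v$ on $\mathbb R\times\Gamma$ (weight included) that vanish outside $[0,\infty)\times\overline S$ and satisfy $\int_{\mathbb R}|\xi+i\sigma|\,\|\hat v(\xi)\|_{1/2,\xi+i\sigma}^2\,d\xi<\infty$,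 where $\hat v$ is the Fourier transform in time. Write $\langle\cdot,\cdot\rangle_\sigma$ for the pairing of $X_S$ with its dual $X_S'$, and $v\ge0$ for nonnegativity almost everywhere. An element of $X_G'$ is called nonnegative if it is nonnegative on all $v\in X_G$ with $v\ge 0$. **Dirichlet-to-Neumann operator.** A causal wave is a tempered distribution $w_\sigma$ in time with values in $H^1(\Omega)$ such that $(\partial_t+\sigma)^2w_\sigma=\Delta w_\sigma$ in $\mathbb R\times\Omega$ in the sense of distributions and $w_\sigma=0$ for $t<0$. Its traction $-\mu\,\partial w_\sigma/\partial\nu|_{\mathbb R\times\Gamma}$ is understood, through Green's formula, as an element of $X_\Gamma'$. The Dirichlet-to-Neumann operator $\mathcal S_\sigma$ is given by $$\mathcal S_\sigma\bigl(w_\sigma|_{\mathbb R\times\Gamma}\bigr)=-\mu\,\frac{\partial w_\sigma}{\partial\nu}\Big|_{\mathbb R\times\Gamma}$$ for causal waves $w_\sigma$, that is, by its graph: $\mathcal S_\sigma u=g$ means that $u$ and $g\in X_\Gamma'$ are the trace and the traction of a causal wave. Let $p_Q$ denote restriction to $Q=\mathbb R\times G$, i.e. from $X_\Gamma'$ to $X_G'$.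 Let $h_\sigma\in X_G'$. **Contact problem (C).** Find a causal wave $w_\sigma$ whose trace $u_\sigma=w_\sigma|_{\mathbb R\times\Gamma}$ lies in $X_G$ (in particular $w_\sigma=0$ on $\mathbb R\times(\Gamma\setminus\overline G)$) and whose traction $g=-\mu\,\partial w_\sigma/\partial\nu$ lies in $X_\Gamma'$, such that on $\mathbb R\times G$ $$w_\sigma\ge0,\qquad -\mu\frac{\partial w_\sigma}{\partial\nu}\ge h_\sigma,\qquad \Bigl(-\mu\frac{\partial w_\sigma}{\partial\nu}-h_\sigma\Bigr)w_\sigma=0 .$$ The last equation means that $\langle p_Qg-h_\sigma,\vartheta u_\sigma\rangle_\sigma=0$ for all bounded smooth $\vartheta$ on $\mathbb R\times\mathbb R^n$ with $\vartheta u_\sigma\in X_G$. **Variational inequality (VI).** Find $u_\sigma\in X_G$ with $u_\sigma\ge 0$ such that $$\langle p_Q\mathcal S_\sigma u_\sigma,v-u_\sigma\rangle_\sigma\ \ge\ \langle h_\sigma,v-u_\sigma\rangle_\sigma\qquad\text{for all }v\in X_G,\ v\ge0 .$$ **Theorem.** (C) and (VI) are equivalent. More precisely: 1. If $w_\sigma$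 is a causal wave with trace $u_\sigma\in X_G$ and traction $g=\mathcal S_\sigma u_\sigma\in X_\Gamma'$, then the three contact conditions on $\mathbb R\times G$ hold if and only if $u_\sigma\ge0$ and $\langle p_Qg,v-u_\sigma\rangle_\sigma\ge\langle h_\sigma,v-u_\sigma\rangle_\sigma$ for all $v\in X_G$ with $v\ge 0$. 2. The trace $u_\sigma$ of every solution $w_\sigma$ of (C) solves (VI). 3. Every solution $u_\sigma$ of (VI) is the trace of a solution $w_\sigma$ of (C). -/

import Mathlib

open MeasureTheory Filter Topology SchwartzMap
open scoped ENNReal NNReal ContDiff Gradient FourierTransform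

noncomputable section

namespace WaveContact

/-- Euclidean space `ℝⁿ`. -/
abbrev Rn (n : ℕ) : Type := EuclideanSpace ℝ (Fin n)

/-! ### Geometry -/

/-- `x` with its component along the unit vector `e` removed. -/
def proj {n : ℕ} (e x : Rn n) : Rn n := x - (inner ℝ e x : ℝ) • e

/-- Near `p`, the set `Ω` is the region below the graph of the Lipschitz function `ζ` of the
variables orthogonal to the unit vector `e`. -/
def IsGraphNear {n : ℕ} (Ω : Set (Rn n)) (p e : Rn n) (ζ : Rn n → ℝ) (r : ℝ) : Prop :=
  ‖e‖ = 1 ∧ (∃ K, LipschitzWith K ζ) ∧ 0 < r ∧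
    ∀ x ∈ Metric.ball p r, (x ∈ Ω ↔ (inner ℝ e x : ℝ) < ζ (proj e x))

/-- An open set whose boundary is locally the graph of a Lipschitz function, with the set lying
on one side of it. -/
def IsLipschitzDomain {n : ℕ} (Ω : Set (Rn n)) : Prop :=
  IsOpen Ω ∧ ∀ p ∈ frontier Ω, ∃ e ζ r, IsGraphNear Ω p e ζ r

/-- A relatively open part `G` of `Γ = ∂Ω` whose relative boundary is Lipschitz: near each point
of it there are orthonormal coordinates in which `Γ` is a Lipschitz graph over the variables
orthogonal to `e` and `G` is the part of this graph lying on one side of a Lipschitz graph in the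
direction `f` orthogonal to `e`. -/
def IsLipschitzPart {n : ℕ} (Ω G : Set (Rn n)) : Prop :=
  (∃ U, IsOpen U ∧ G = U ∩ frontier Ω) ∧
    ∀ p ∈ closure G \ G, ∃ e ζ r, IsGraphNear Ω p e ζ r ∧
      ∃ f : Rn n, ∃ ρ : Rn n → ℝ, ‖f‖ = 1 ∧ (inner ℝ e f : ℝ) = 0 ∧ (∃ K, LipschitzWith K ρ) ∧
        ∀ x ∈ Metric.ball p r ∩ frontier Ω,
          (x ∈ G ↔ ρ (proj f (proj e x)) < (inner ℝ f x : ℝ))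

lemma IsLipschitzPart.subset {n : ℕ} {Ω G : Set (Rn n)} (h : IsLipschitzPart Ω G) :
    G ⊆ frontier Ω := by
  obtain ⟨⟨U, -, rfl⟩, -⟩ := h
  exact Set.inter_subset_right

/-- The open half-space `{x ∈ ℝⁿ : xₙ > 0}`. -/
def halfSpace (n : ℕ) : Set (Rn n) := {x | ∀ i : Fin n, (i : ℕ) + 1 = n → 0 < x i}

/-- Surface measure on `∂Ω` (up to a positive constant factor depending only on `n`). -/
def surf {n : ℕ} (Ω : Set (Rn n)) : Measure (Rn n) := (μH[(n : ℝ) - 1]).restrict (frontier Ω)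

/-! ### The anisotropic space `H^{1/2}_σ(ℝ⁺, H̃^{1/2}(S))`

All functions carry the exponential weight: `u` here is `u_σ = e^{-σt} · (unweighted function)`.
The frequency is `ω = 2πξ + iσ` (time Fourier transform `∫ e^{-2πitξ} u(t) dt`). -/

/-- `|ω|` for `ω = 2πξ + iσ`. -/
def freq (σ ξ : ℝ) : ℝ := Real.sqrt ((2 * Real.pi * ξ) ^ 2 + σ ^ 2)

/-- `û` is the Fourier transform of `u` in time: for a.e. boundary point `x` both `u(·,x)` and
`û(·,x)` are square integrable, and `û(·,x)` is the Fourier-Plancherel transform of `u(·,x)`. -/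
def IsTimeFourier {n : ℕ} (Ω : Set (Rn n)) (u : ℝ → Rn n → ℝ) (U : ℝ → Rn n → ℂ) : Prop :=
  Measurable (Function.uncurry U) ∧
    ∀ᵐ x ∂(surf Ω), MemLp (fun t => u t x) 2 volume ∧ MemLp (fun ξ => U ξ x) 2 volume ∧
      ∀ φ : 𝓢(ℝ, ℂ), ∫ ξ, U ξ x * φ ξ = ∫ t, (u t x : ℂ) * (𝓕 φ) t

/-- The square of the norm of `H^s_σ(ℝ⁺, H^{1/2}(∂Ω))`, in terms of the time Fourier transform:
`∫ |ω|^{2s} ‖û(ξ)‖²_{1/2,ω} dξ`, where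
`‖v‖²_{1/2,ω} = |ω| ∫ |v|² ds + ∫∫ |v(x)-v(y)|² / |x-y|ⁿ ds_x ds_y`
is the Sobolev-Slobodeckij form of the `ω`-dependent norm of `H^{1/2}` of the
`(n-1)`-dimensional surface `∂Ω` (Fourier weight `(|ω|²+|ξ'|²)^{1/2} ≃ |ω| + |ξ'|`). -/
def energy {n : ℕ} (σ s : ℝ) (Ω : Set (Rn n)) (U : ℝ → Rn n → ℂ) : ℝ≥0∞ :=
  (∫⁻ p : ℝ × Rn n, ENNReal.ofReal (freq σ p.1 ^ (2 * s) * freq σ p.1) * ‖U p.1 p.2‖ₑ ^ 2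
      ∂((volume : Measure ℝ).prod (surf Ω))) +
    ∫⁻ q : ℝ × (Rn n × Rn n), ENNReal.ofReal (freq σ q.1 ^ (2 * s)) *
      (‖U q.1 q.2.1 - U q.1 q.2.2‖ₑ ^ 2 / ‖q.2.1 - q.2.2‖ₑ ^ n)
      ∂((volume : Measure ℝ).prod ((surf Ω).prod (surf Ω)))

/-- Equality almost everywhere on `ℝ × ∂Ω`. -/
def AEEq {n : ℕ} (Ω : Set (Rn n)) (u v : ℝ → Rn n → ℝ) : Prop :=
  ∀ᵐ p ∂((volume : Measure ℝ).prod (surf Ω)), u p.1 p.2 = v p.1 p.2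

/-- Nonnegativity almost everywhere on `ℝ × ∂Ω`. -/
def AENonneg {n : ℕ} (Ω : Set (Rn n)) (u : ℝ → Rn n → ℝ) : Prop :=
  ∀ᵐ p ∂((volume : Measure ℝ).prod (surf Ω)), 0 ≤ u p.1 p.2

lemma measurable_freq (σ : ℝ) : Measurable (freq σ) := by
  unfold freq; fun_prop

lemma enorm_add_sq_le {E : Type*} [NormedAddCommGroup E] (a b : E) :
    ‖a + b‖ₑ ^ 2 ≤ 2 * ‖a‖ₑ ^ 2 + 2 * ‖b‖ₑ ^ 2 := by
  have h := ENNReal.rpow_add_le_mul_rpow_add_rpow ‖a‖ₑ ‖b‖ₑ (p := 2) (by norm_num)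
  have h1 : ‖a + b‖ₑ ^ 2 ≤ (‖a‖ₑ + ‖b‖ₑ) ^ 2 := by gcongr; exact enorm_add_le a b
  refine h1.trans ?_
  have e : (2 : ℝ≥0∞) ^ ((2 : ℝ) - 1) = 2 := by norm_num
  rw [e] at h
  simp only [ENNReal.rpow_two] at h
  rwa [mul_add] at h

lemma energy_add_le {n : ℕ} (σ s : ℝ) (Ω : Set (Rn n)) {U V : ℝ → Rn n → ℂ}
    (hU : Measurable (Function.uncurry U)) :
    energy σ s Ω (U + V) ≤ 2 * energy σ s Ω U + 2 * energy σ s Ω V := by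
  have hf := measurable_freq σ
  have hU1 : Measurable (fun p : ℝ × Rn n => U p.1 p.2) := hU
  have hU2 : Measurable (fun q : ℝ × (Rn n × Rn n) => U q.1 q.2.1) :=
    hU.comp (measurable_fst.prodMk (measurable_fst.comp measurable_snd))
  have hU3 : Measurable (fun q : ℝ × (Rn n × Rn n) => U q.1 q.2.2) :=
    hU.comp (measurable_fst.prodMk (measurable_snd.comp measurable_snd))
  have hm1 : Measurable (fun p : ℝ × Rn n =>
      ENNReal.ofReal (freq σ p.1 ^ (2 * s) * freq σ p.1) * ‖U p.1 p.2‖ₑ ^ 2) := by fun_prop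
  have hm2 : Measurable (fun q : ℝ × (Rn n × Rn n) => ENNReal.ofReal (freq σ q.1 ^ (2 * s)) *
      (‖U q.1 q.2.1 - U q.1 q.2.2‖ₑ ^ 2 / ‖q.2.1 - q.2.2‖ₑ ^ n)) := by fun_prop
  unfold energy
  calc _ ≤ (2 * (∫⁻ p : ℝ × Rn n, ENNReal.ofReal (freq σ p.1 ^ (2 * s) * freq σ p.1) *
              ‖U p.1 p.2‖ₑ ^ 2 ∂((volume : Measure ℝ).prod (surf Ω)))
          + 2 * ∫⁻ p : ℝ × Rn n, ENNReal.ofReal (freq σ p.1 ^ (2 * s) * freq σ p.1) *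
              ‖V p.1 p.2‖ₑ ^ 2 ∂((volume : Measure ℝ).prod (surf Ω))) +
        (2 * (∫⁻ q : ℝ × (Rn n × Rn n), ENNReal.ofReal (freq σ q.1 ^ (2 * s)) *
              (‖U q.1 q.2.1 - U q.1 q.2.2‖ₑ ^ 2 / ‖q.2.1 - q.2.2‖ₑ ^ n)
              ∂((volume : Measure ℝ).prod ((surf Ω).prod (surf Ω))))
          + 2 * ∫⁻ q : ℝ × (Rn n × Rn n), ENNReal.ofReal (freq σ q.1 ^ (2 * s)) *
              (‖V q.1 q.2.1 - V q.1 q.2.2‖ₑ ^ 2 / ‖q.2.1 - q.2.2‖ₑ ^ n)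
              ∂((volume : Measure ℝ).prod ((surf Ω).prod (surf Ω)))) := by
        gcongr
        · rw [← lintegral_const_mul' _ _ (by norm_num), ← lintegral_const_mul' _ _ (by norm_num),
            ← lintegral_add_left (hm1.const_mul 2)]
          refine lintegral_mono fun p => ?_
          calc _ ≤ ENNReal.ofReal (freq σ p.1 ^ (2 * s) * freq σ p.1) *
                (2 * ‖U p.1 p.2‖ₑ ^ 2 + 2 * ‖V p.1 p.2‖ₑ ^ 2) := by
                gcongr; exact enorm_add_sq_le _ _
            _ = _ := by ring
        · rw [← lintegral_const_mul' _ _ (by norm_num), ← lintegral_const_mul' _ _ (by norm_num),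
            ← lintegral_add_left (hm2.const_mul 2)]
          refine lintegral_mono fun q => ?_
          have e : (U + V) q.1 q.2.1 - (U + V) q.1 q.2.2 =
              (U q.1 q.2.1 - U q.1 q.2.2) + (V q.1 q.2.1 - V q.1 q.2.2) := by
            simp only [Pi.add_apply]; ring
          calc _ ≤ ENNReal.ofReal (freq σ q.1 ^ (2 * s)) *
                ((2 * ‖U q.1 q.2.1 - U q.1 q.2.2‖ₑ ^ 2 + 2 * ‖V q.1 q.2.1 - V q.1 q.2.2‖ₑ ^ 2) /
                  ‖q.2.1 - q.2.2‖ₑ ^ n) := by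
                rw [e]; gcongr; exact enorm_add_sq_le _ _
            _ = _ := by simp only [ENNReal.div_eq_inv_mul]; ring
    _ = _ := by ring

lemma energy_smul {n : ℕ} (σ s : ℝ) (Ω : Set (Rn n)) (c : ℂ) (U : ℝ → Rn n → ℂ) :
    energy σ s Ω (c • U) = ‖c‖ₑ ^ 2 * energy σ s Ω U := by
  unfold energy
  have hc : ‖c‖ₑ ^ 2 ≠ ⊤ := ENNReal.pow_ne_top enorm_ne_top
  rw [mul_add, ← lintegral_const_mul' _ _ hc, ← lintegral_const_mul' _ _ hc]
  congr 1
  · refine lintegral_congr fun p => ?_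
    simp only [Pi.smul_apply, enorm_smul]; ring
  · refine lintegral_congr fun q => ?_
    simp only [Pi.smul_apply, ← smul_sub, enorm_smul, ENNReal.div_eq_inv_mul]; ring

lemma integrable_mul_schwartz {f : ℝ → ℂ} (hf : MemLp f 2 volume) (φ : 𝓢(ℝ, ℂ)) :
    Integrable (fun t => f t * φ t) :=
  hf.integrable_mul (φ.memLp 2 volume)

lemma IsTimeFourier.add {n : ℕ} {Ω : Set (Rn n)} {u v : ℝ → Rn n → ℝ} {U V : ℝ → Rn n → ℂ}
    (hu : IsTimeFourier Ω u U) (hv : IsTimeFourier Ω v V) :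
    IsTimeFourier Ω (u + v) (U + V) := by
  refine ⟨hu.1.add hv.1, ?_⟩
  filter_upwards [hu.2, hv.2] with x h1 h2
  refine ⟨h1.1.add h2.1, h1.2.1.add h2.2.1, fun φ => ?_⟩
  simp only [Pi.add_apply, Complex.ofReal_add, add_mul]
  have i1 : Integrable (fun t => (u t x : ℂ) * (𝓕 φ) t) := integrable_mul_schwartz h1.1.ofReal _
  have i2 : Integrable (fun t => (v t x : ℂ) * (𝓕 φ) t) := integrable_mul_schwartz h2.1.ofReal _
  rw [integral_add (integrable_mul_schwartz h1.2.1 φ) (integrable_mul_schwartz h2.2.1 φ),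
    integral_add i1 i2, h1.2.2 φ, h2.2.2 φ]

lemma IsTimeFourier.smul {n : ℕ} {Ω : Set (Rn n)} {u : ℝ → Rn n → ℝ} {U : ℝ → Rn n → ℂ}
    (c : ℝ) (hu : IsTimeFourier Ω u U) : IsTimeFourier Ω (c • u) ((c : ℂ) • U) := by
  refine ⟨hu.1.const_smul (c : ℂ), ?_⟩
  filter_upwards [hu.2] with x h1
  refine ⟨h1.1.const_smul c, h1.2.1.const_smul (c : ℂ), fun φ => ?_⟩
  simp only [Pi.smul_apply, smul_eq_mul, Complex.ofReal_mul, mul_assoc]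
  rw [integral_const_mul, integral_const_mul, h1.2.2 φ]

/-- `H^{1/2}_σ(ℝ⁺, H̃^{1/2}(S))` for a part `S` of `Γ = ∂Ω`: real functions on `ℝ × ∂Ω` (with the
weight `e^{-σt}` included), supported in `[0,∞) × closure S`, with finite norm. As usual, its
elements matter only up to equality a.e. For `S = ∂Ω` this is `H^{1/2}_σ(ℝ⁺, H^{1/2}(∂Ω))`. -/
def energySpace {n : ℕ} (σ : ℝ) (Ω S : Set (Rn n)) : Submodule ℝ (ℝ → Rn n → ℝ) where
  carrier := {u | Measurable (Function.uncurry u) ∧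
    (∀ᵐ p ∂((volume : Measure ℝ).prod (surf Ω)), p.1 < 0 ∨ p.2 ∉ closure S → u p.1 p.2 = 0) ∧
    ∃ U, IsTimeFourier Ω u U ∧ energy σ (1 / 2) Ω U < ⊤}
  add_mem' := by
    rintro u v ⟨hu, hu0, U, hU, hUe⟩ ⟨hv, hv0, V, hV, hVe⟩
    refine ⟨hu.add hv, ?_, U + V, hU.add hV, (energy_add_le σ _ Ω hU.1).trans_lt ?_⟩
    · filter_upwards [hu0, hv0] with p h1 h2 hp
      simp [h1 hp, h2 hp]
    · exact ENNReal.add_lt_top.2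
        ⟨ENNReal.mul_lt_top (by simp) hUe, ENNReal.mul_lt_top (by simp) hVe⟩
  zero_mem' := by
    refine ⟨measurable_const, by simp, 0, ⟨measurable_const, by simp⟩, ?_⟩
    simp [energy]
  smul_mem' := by
    rintro c u ⟨hu, hu0, U, hU, hUe⟩
    refine ⟨hu.const_smul c, ?_, (c : ℂ) • U, hU.smul c, ?_⟩
    · filter_upwards [hu0] with p h1 hp
      simp [h1 hp]
    · rw [energy_smul]
      exact ENNReal.mul_lt_top (ENNReal.pow_lt_top enorm_lt_top) hUe

lemma energySpace_mono {n : ℕ} (σ : ℝ) (Ω : Set (Rn n)) {S T : Set (Rn n)} (h : S ⊆ T) :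
    energySpace σ Ω S ≤ energySpace σ Ω T := by
  rintro u ⟨hu, hu0, hU⟩
  refine ⟨hu, ?_, hU⟩
  filter_upwards [hu0] with p h1 hp
  exact h1 (hp.imp_right fun hx hx' => hx (closure_mono h hx'))

/-- Continuity of a linear functional on `H^{1/2}_σ(ℝ⁺, H̃^{1/2}(S))`. The continuous functionals
form the dual space, i.e. the space `H^{-1/2}_σ(ℝ⁺, H^{-1/2}(S))` of (weighted) distributions on
`ℝ⁺ × S`; the value at `v` is the duality pairing `⟨·, v⟩_σ` that extends
`∫∫ g v ds dt = ∫ e^{-2σt} ∫ (e^{σt} g) (e^{σt} v) ds dt`. -/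
def IsContinuousFunctional {n : ℕ} {σ : ℝ} {Ω S : Set (Rn n)}
    (g : energySpace σ Ω S →ₗ[ℝ] ℝ) : Prop :=
  ∃ C : ℝ≥0, ∀ (v : energySpace σ Ω S) (V : ℝ → Rn n → ℂ), IsTimeFourier Ω v.1 V →
    ENNReal.ofReal (g v ^ 2) ≤ C * energy σ (1 / 2) Ω V

/-- `p_Q`: restriction of a distribution on `ℝ × ∂Ω` to `Q = ℝ × G`. -/
def restrictTo {n : ℕ} {σ : ℝ} {Ω G : Set (Rn n)} (hG : G ⊆ frontier Ω)
    (g : energySpace σ Ω (frontier Ω) →ₗ[ℝ] ℝ) : energySpace σ Ω G →ₗ[ℝ] ℝ :=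
  g ∘ₗ Submodule.inclusion (energySpace_mono σ Ω hG)

/-! ### `H¹(Ω)`, traces, and the exponentially weighted wave equation -/

lemma memLp_test {n : ℕ} (Ω : Set (Rn n)) {ψ : Rn n → ℝ} (h : ContDiff ℝ ∞ ψ)
    (hc : HasCompactSupport ψ) : MemLp ψ 2 (volume.restrict Ω) :=
  (h.continuous.memLp_of_hasCompactSupport hc).restrict Ω

lemma memLp_gradient_test {n : ℕ} (Ω : Set (Rn n)) {ψ : Rn n → ℝ} (h : ContDiff ℝ ∞ ψ)
    (hc : HasCompactSupport ψ) : MemLp (∇ ψ) 2 (volume.restrict Ω) := by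
  have h1 : Continuous (∇ ψ) :=
    (InnerProductSpace.toDual ℝ (Rn n)).symm.continuous.comp (h.continuous_fderiv (by simp))
  have h2 : HasCompactSupport (∇ ψ) := by
    have := (hc.fderiv ℝ).comp_left (g := (InnerProductSpace.toDual ℝ (Rn n)).symm) (map_zero _)
    exact this
  exact (h1.memLp_of_hasCompactSupport h2).restrict Ω

lemma integrable_smul_of_memLp {n : ℕ} {m : Measure (Rn n)} {f : Rn n → ℝ} {F : Rn n → Rn n}
    (hf : MemLp f 2 m) (hF : MemLp F 2 m) : Integrable (fun x => f x • F x) m :=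
  memLp_one_iff_integrable.1 (hF.smul hf)

/-- The Sobolev space `H¹(Ω)`: pairs of a function in `L²(Ω)` and its weak gradient in
`L²(Ω; ℝⁿ)`. -/
def H1 {n : ℕ} (Ω : Set (Rn n)) :
    Submodule ℝ (Lp ℝ 2 (volume.restrict Ω) × Lp (Rn n) 2 (volume.restrict Ω)) where
  carrier := {f | ∀ ψ : Rn n → ℝ, ContDiff ℝ ∞ ψ → HasCompactSupport ψ → tsupport ψ ⊆ Ω →
    ∫ x in Ω, f.1 x • ∇ ψ x = - ∫ x in Ω, ψ x • f.2 x}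
  add_mem' := by
    intro f g hf hg ψ h1 h2 h3
    have i1 := fun k : Lp ℝ 2 (volume.restrict Ω) =>
      integrable_smul_of_memLp (Lp.memLp k) (memLp_gradient_test Ω h1 h2)
    have i2 := fun k : Lp (Rn n) 2 (volume.restrict Ω) =>
      integrable_smul_of_memLp (memLp_test Ω h1 h2) (Lp.memLp k)
    have e1 : ∫ x in Ω, (f + g).1 x • ∇ ψ x = ∫ x in Ω, (f.1 x • ∇ ψ x + g.1 x • ∇ ψ x) := by
      refine integral_congr_ae ?_
      filter_upwards [Lp.coeFn_add f.1 g.1] with x hx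
      rw [Prod.fst_add, hx, Pi.add_apply, add_smul]
    have e2 : ∫ x in Ω, ψ x • (f + g).2 x = ∫ x in Ω, (ψ x • f.2 x + ψ x • g.2 x) := by
      refine integral_congr_ae ?_
      filter_upwards [Lp.coeFn_add f.2 g.2] with x hx
      rw [Prod.snd_add, hx, Pi.add_apply, smul_add]
    rw [e1, e2, integral_add (i1 f.1) (i1 g.1), integral_add (i2 f.2) (i2 g.2),
      hf ψ h1 h2 h3, hg ψ h1 h2 h3, neg_add]
  zero_mem' := by
    intro ψ h1 h2 h3
    have e1 : ∫ x in Ω, (0 : Lp ℝ 2 (volume.restrict Ω)) x • ∇ ψ x = 0 := by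
      rw [integral_eq_zero_of_ae]
      filter_upwards [Lp.coeFn_zero ℝ 2 (volume.restrict Ω)] with x hx
      rw [hx]; simp
    have e2 : ∫ x in Ω, ψ x • (0 : Lp (Rn n) 2 (volume.restrict Ω)) x = 0 := by
      rw [integral_eq_zero_of_ae]
      filter_upwards [Lp.coeFn_zero (Rn n) 2 (volume.restrict Ω)] with x hx
      rw [hx]; simp
    simp only [Prod.fst_zero, Prod.snd_zero]
    rw [e1, e2, neg_zero]
  smul_mem' := by
    intro c f hf ψ h1 h2 h3
    have e1 : ∫ x in Ω, (c • f).1 x • ∇ ψ x = ∫ x in Ω, c • (f.1 x • ∇ ψ x) := by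
      refine integral_congr_ae ?_
      filter_upwards [Lp.coeFn_smul c f.1] with x hx
      rw [Prod.smul_fst, hx, Pi.smul_apply, smul_assoc]
    have e2 : ∫ x in Ω, ψ x • (c • f).2 x = ∫ x in Ω, c • (ψ x • f.2 x) := by
      refine integral_congr_ae ?_
      filter_upwards [Lp.coeFn_smul c f.2] with x hx
      rw [Prod.smul_snd, hx, Pi.smul_apply, smul_comm]
    rw [e1, e2, integral_smul, integral_smul, hf ψ h1 h2 h3, smul_neg]

/-- The space-time displacement: a tempered distribution in time with values in `H¹(Ω)`. It stands
for `w_σ = e^{-σt} w`. -/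
abbrev Displacement {n : ℕ} (Ω : Set (Rn n)) : Type := 𝓢(ℝ, ℝ) →L[ℝ] H1 Ω

/-- `b` is the trace on `∂Ω` of `f ∈ H¹(Ω)`: the limit in `L²(∂Ω)` of the boundary values of
smooth functions that converge to `f` in `H¹(Ω)`. -/
def IsTrace {n : ℕ} (Ω : Set (Rn n)) (f : H1 Ω) (b : Rn n → ℝ) : Prop :=
  ∃ ψ : ℕ → Rn n → ℝ, (∀ k, ContDiff ℝ ∞ (ψ k) ∧ HasCompactSupport (ψ k)) ∧
    Tendsto (fun k => eLpNorm (fun x => ψ k x - f.1.1 x) 2 (volume.restrict Ω)) atTop (𝓝 0) ∧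
    Tendsto (fun k => eLpNorm (fun x => ∇ (ψ k) x - f.1.2 x) 2 (volume.restrict Ω))
      atTop (𝓝 0) ∧
    Tendsto (fun k => eLpNorm (fun x => ψ k x - b x) 2 (surf Ω)) atTop (𝓝 0)

/-- `w|_{ℝ × ∂Ω} = u`. -/
def HasBoundaryTrace {n : ℕ} {Ω : Set (Rn n)} (w : Displacement Ω) (u : ℝ → Rn n → ℝ) : Prop :=
  ∀ φ : 𝓢(ℝ, ℝ), IsTrace Ω (w φ) (fun x => ∫ t, φ t * u t x)

/-- The transpose `σ - ∂_t` of `∂_t + σ`. -/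
def adjTime (σ : ℝ) (φ : 𝓢(ℝ, ℝ)) : 𝓢(ℝ, ℝ) := σ • φ - derivCLM ℝ ℝ φ

/-- `∫∫ (∇w · ∇ψ) φ + ∫∫ ((∂_t + σ)² w) φ ψ` over `ℝ × Ω`, for the test function `φ(t) ψ(x)`. -/
def greenForm {n : ℕ} {Ω : Set (Rn n)} (σ : ℝ) (w : Displacement Ω) (φ : 𝓢(ℝ, ℝ))
    (ψ : Rn n → ℝ) : ℝ :=
  (∫ x in Ω, (inner ℝ ((w φ).1.2 x) (∇ ψ x) : ℝ)) +
    ∫ x in Ω, (w (adjTime σ (adjTime σ φ))).1.1 x * ψ x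

/-- `(∂_t + σ)² w = Δ w` in `ℝ × Ω`, in the sense of distributions, and `w = 0` for `t < 0`. -/
structure IsCausalWave {n : ℕ} {Ω : Set (Rn n)} (σ : ℝ) (w : Displacement Ω) : Prop where
  wave : ∀ (φ : 𝓢(ℝ, ℝ)) (ψ : Rn n → ℝ), ContDiff ℝ ∞ ψ → HasCompactSupport ψ →
    tsupport ψ ⊆ Ω → greenForm σ w φ ψ = 0
  causal : ∀ φ : 𝓢(ℝ, ℝ), tsupport φ ⊆ Set.Iio 0 → w φ = 0

/-- `g = -μ ∂w/∂ν` on `ℝ × ∂Ω`, as an element of the dual of `H^{1/2}_σ(ℝ⁺, H^{1/2}(∂Ω))`,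
defined through Green's formula. As in the half-space `{xₙ > 0}` with `∂/∂ν = ∂/∂xₙ`, the normal
`ν` points into `Ω`, so that `-∂w/∂ν` is the outward derivative. -/
def IsTraction {n : ℕ} {σ : ℝ} {Ω : Set (Rn n)} (μ : ℝ) (w : Displacement Ω)
    (g : energySpace σ Ω (frontier Ω) →ₗ[ℝ] ℝ) : Prop :=
  IsContinuousFunctional g ∧
    ∀ (φ : 𝓢(ℝ, ℝ)) (ψ : Rn n → ℝ), tsupport φ ⊆ Set.Ioi 0 → ContDiff ℝ ∞ ψ →
      HasCompactSupport ψ → ∀ v : energySpace σ Ω (frontier Ω),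
        AEEq Ω v.1 (fun t x => φ t * ψ x) → g v = μ * greenForm σ w φ ψ

/-! ### The Dirichlet-to-Neumann operator, the contact problem and the variational inequality -/

/-- The graph of the Dirichlet-to-Neumann operator `S_σ : w|_{ℝ × ∂Ω} ↦ -μ ∂w/∂ν|_{ℝ × ∂Ω}` for
the causal solutions `w` of the weighted wave equation: `IsDtN σ μ u g` means `S_σ u = g`. -/
def IsDtN {n : ℕ} {Ω : Set (Rn n)} (σ μ : ℝ) (u : ℝ → Rn n → ℝ)
    (g : energySpace σ Ω (frontier Ω) →ₗ[ℝ] ℝ) : Prop :=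
  ∃ w : Displacement Ω, IsCausalWave σ w ∧ HasBoundaryTrace w u ∧ IsTraction μ w g

/-- The unilateral conditions on `Q = ℝ × G` for a displacement `u` and a traction `g`:
`u ≥ 0`, `g ≥ h` and `(g - h) u = 0`. The second one says that `g - h` is a nonnegative element of
the dual space; the third one says that the product of the distribution `g - h` with the function
`u`, which is `ϑ ↦ ⟨g - h, ϑ u⟩`, vanishes for all bounded smooth `ϑ`. -/
structure UnilateralConditions {n : ℕ} {σ : ℝ} {Ω G : Set (Rn n)}
    (h g : energySpace σ Ω G →ₗ[ℝ] ℝ) (u : energySpace σ Ω G) : Prop where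
  displacement_nonneg : AENonneg Ω u.1
  traction_ge : ∀ v : energySpace σ Ω G, AENonneg Ω v.1 → h v ≤ g v
  complementarity : ∀ ϑ : ℝ → Rn n → ℝ, ContDiff ℝ ∞ (Function.uncurry ϑ) →
    (∃ C, ∀ t x, |ϑ t x| ≤ C) → ∀ v : energySpace σ Ω G,
      AEEq Ω v.1 (fun t x => ϑ t x * u.1 t x) → g v - h v = 0

/-- `w` solves the exponentially weighted contact problem, with boundary trace
`u ∈ H^{1/2}_σ(ℝ⁺, H̃^{1/2}(G))` (in particular `w = 0` on `ℝ × (∂Ω \ closure G)`). -/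
def SolvesContact {n : ℕ} {σ : ℝ} {Ω G : Set (Rn n)} (hG : G ⊆ frontier Ω) (μ : ℝ)
    (h : energySpace σ Ω G →ₗ[ℝ] ℝ) (w : Displacement Ω) (u : energySpace σ Ω G) : Prop :=
  IsCausalWave σ w ∧ HasBoundaryTrace w u.1 ∧
    ∃ g : energySpace σ Ω (frontier Ω) →ₗ[ℝ] ℝ, IsTraction μ w g ∧
      UnilateralConditions h (restrictTo hG g) u

/-- The inequality `u ≥ 0` and `⟨g, v - u⟩ ≥ ⟨h, v - u⟩` for all `v ≥ 0`. -/
def VarIneq {n : ℕ} {σ : ℝ} {Ω G : Set (Rn n)} (h g : energySpace σ Ω G →ₗ[ℝ] ℝ)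
    (u : energySpace σ Ω G) : Prop :=
  AENonneg Ω u.1 ∧ ∀ v : energySpace σ Ω G, AENonneg Ω v.1 → h (v - u) ≤ g (v - u)

/-- `u` solves the variational inequality
`u ≥ 0` and `⟨p_Q S_σ u, v - u⟩ ≥ ⟨h, v - u⟩` for all `v ≥ 0` in `H^{1/2}_σ(ℝ⁺, H̃^{1/2}(G))`. -/
def SolvesVI {n : ℕ} {σ : ℝ} {Ω G : Set (Rn n)} (hG : G ⊆ frontier Ω) (μ : ℝ)
    (h : energySpace σ Ω G →ₗ[ℝ] ℝ) (u : energySpace σ Ω G) : Prop :=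
  ∃ g : energySpace σ Ω (frontier Ω) →ₗ[ℝ] ℝ, IsDtN σ μ u.1 g ∧ VarIneq h (restrictTo hG g) u

end WaveContact

end

namespace WaveContact

variable {n : ℕ} {σ : ℝ} {Ω G : Set (Rn n)}

/-! The nonnegative elements of `energySpace σ Ω G` form a convex cone, and for a linear functional
`g - h` the variational inequality over a cone is the same as complementarity: `u` lies in the cone,
`g - h` is nonnegative on the cone, and `g - h` vanishes at `u`. Adding a cone element to `u` gives
nonnegativity (`VarIneq.le`); moving along the ray through `u`, to `0` and to `2u`, gives the
vanishing (`VarIneq.apply_self`).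

What remains is to pass from the single number `⟨g - h, u⟩` to the product `(g - h) u` as a
distribution. For `|ϑ| ≤ C` the function `ϑ u` lies between `-C u` and `C u`, so a functional that
is nonnegative on the cone and zero at `u` is zero at `ϑ u` as well
(`VarIneq.unilateralConditions`).

The wave equation plays no part in this equivalence. It only ties the pair `(u, g)` to a causal wave
`w`, and since `S_σ` is given by its graph, the same `w` serves for both problems; no solvability or
uniqueness is needed. -/

/-- The unilateral conditions give the variational inequality: testing the complementarity with
the constant function `1` yields `⟨g - h, u⟩ = 0`. -/
theorem UnilateralConditions.varIneq {h g : energySpace σ Ω G →ₗ[ℝ] ℝ} {u : energySpace σ Ω G}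
    (H : UnilateralConditions h g u) : VarIneq h g u := by
  refine ⟨H.displacement_nonneg, fun v hv => ?_⟩
  have hgu : g u - h u = 0 := by
    refine H.complementarity (fun _ _ => 1) contDiff_const ⟨1, by simp⟩ u ?_
    exact Eventually.of_forall fun p => (one_mul _).symm
  have hgv := H.traction_ge v hv
  rw [map_sub, map_sub]
  linarith

/-- Testing the variational inequality with `u + v` for `v ≥ 0`. -/
theorem VarIneq.le {h g : energySpace σ Ω G →ₗ[ℝ] ℝ} {u : energySpace σ Ω G}
    (H : VarIneq h g u) (v : energySpace σ Ω G) (hv : AENonneg Ω v.1) : h v ≤ g v := by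
  have huv : AENonneg Ω (u + v).1 := by
    filter_upwards [H.1, hv] with p hp hq using add_nonneg hp hq
  simpa using H.2 (u + v) huv

/-- Testing the variational inequality with `0` and, through `VarIneq.le`, with `2u`. -/
theorem VarIneq.apply_self {h g : energySpace σ Ω G →ₗ[ℝ] ℝ} {u : energySpace σ Ω G}
    (H : VarIneq h g u) : g u = h u := by
  -- The competitor `0` gives `g u ≤ h u`; the reverse bound is `H.le` at `v = u`, whose competitor
  -- is `u + u`.
  have h0 := H.2 0 (Eventually.of_forall fun _ => le_rfl)
  rw [zero_sub, map_neg, map_neg] at h0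
  exact le_antisymm (neg_le_neg_iff.1 h0) (H.le u H.1)

/-- The variational inequality gives the unilateral conditions: if `|ϑ| ≤ C`, then both `C u + ϑ u`
and `C u - ϑ u` are nonnegative, so that `⟨g - h, ϑ u⟩` is bounded by `± C ⟨g - h, u⟩ = 0`. -/
theorem VarIneq.unilateralConditions {h g : energySpace σ Ω G →ₗ[ℝ] ℝ} {u : energySpace σ Ω G}
    (H : VarIneq h g u) : UnilateralConditions h g u where
  displacement_nonneg := H.1
  traction_ge := H.le
  complementarity := by
    -- Smoothness of `ϑ` is dropped: only the bound `C` matters. That `ϑ u` belongs to the space is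
    -- supplied by its representative `v`.
    rintro ϑ - ⟨C, hC⟩ v hv
    -- Almost everywhere this is `(C + ϑ) u`, a product of two nonnegative factors; below, `C • u -
    -- v` is `(C - ϑ) u`.
    have hadd : AENonneg Ω (C • u + v).1 := by
      filter_upwards [H.1, hv] with p hp hq
      change 0 ≤ C * u.1 p.1 p.2 + v.1 p.1 p.2
      rw [hq, ← add_mul]
      exact mul_nonneg (by linarith [(abs_le.1 (hC p.1 p.2)).1]) hp
    have hsub : AENonneg Ω (C • u - v).1 := by
      filter_upwards [H.1, hv] with p hp hq
      change 0 ≤ C * u.1 p.1 p.2 - v.1 p.1 p.2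
      rw [hq, ← sub_mul]
      exact mul_nonneg (by linarith [(abs_le.1 (hC p.1 p.2)).2]) hp
    have h1 := H.le _ hadd
    have h2 := H.le _ hsub
    -- Replacing `g u` by `h u` makes the `C`-terms agree on both sides, so `h1` and `h2` bound `g v
    -- - h v` from below and above by zero.
    simp only [map_add, map_sub, map_smul, H.apply_self] at h1 h2
    linarith

/-- Purely order-theoretic: `g` is an arbitrary linear functional here, and the main theorem takes
it to be the restricted traction `p_Q g`. -/
theorem unilateralConditions_iff_varIneq {h g : energySpace σ Ω G →ₗ[ℝ] ℝ}
    {u : energySpace σ Ω G} : UnilateralConditions h g u ↔ VarIneq h g u :=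
  ⟨UnilateralConditions.varIneq, VarIneq.unilateralConditions⟩

end WaveContact

theorem theorem4p2 (n : ℕ) (hn : 2 ≤ n) (Ω G : Set (WaveContact.Rn n))
    (hΩ : WaveContact.IsLipschitzDomain Ω)
    (hΩ' : Bornology.IsBounded Ω ∨ Ω = WaveContact.halfSpace n)
    (hG : WaveContact.IsLipschitzPart Ω G)
    (hGb : Bornology.IsBounded G) (σ μ : ℝ) (hσ : 0 < σ) (hμ : 0 < μ)
    (h : WaveContact.energySpace σ Ω G →ₗ[ℝ] ℝ) (hh : WaveContact.IsContinuousFunctional h) :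
    (∀ (w : WaveContact.Displacement Ω) (u : WaveContact.energySpace σ Ω G)
        (g : WaveContact.energySpace σ Ω (frontier Ω) →ₗ[ℝ] ℝ),
        WaveContact.IsCausalWave σ w → WaveContact.HasBoundaryTrace w u.1 →
        WaveContact.IsTraction μ w g →
        (WaveContact.UnilateralConditions h (WaveContact.restrictTo hG.subset g) u ↔
          WaveContact.VarIneq h (WaveContact.restrictTo hG.subset g) u)) ∧
      (∀ (w : WaveContact.Displacement Ω) (u : WaveContact.energySpace σ Ω G),
        WaveContact.SolvesContact hG.subset μ h w u → WaveContact.SolvesVI hG.subset μ h u) ∧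
      (∀ u : WaveContact.energySpace σ Ω G, WaveContact.SolvesVI hG.subset μ h u →
        ∃ w : WaveContact.Displacement Ω, WaveContact.SolvesContact hG.subset μ h w u) := by
  refine ⟨fun w u g _ _ _ => WaveContact.unilateralConditions_iff_varIneq, ?_, ?_⟩
  · rintro w u ⟨hw, hu, g, hg, hc⟩
    -- The contact solution `w` itself witnesses that `(u, g)` is in the graph of `S_σ`.
    exact ⟨g, ⟨w, hw, hu, hg⟩, hc.varIneq⟩
  · rintro u ⟨g, ⟨w, hw, hu, hg⟩, hvi⟩
    -- Conversely, the wave `w` comes from the graph of `S_σ`, with its traction `g` unchanged.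
    exact ⟨w, hw, hu, g, hg, hvi.unilateralConditions⟩
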